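/- A \emph{rig} is a set $A$ with commutative monoid structures $(A,+,0)$ and $(A,\cdot,1)$ such that $a\cdot 0=0$ and $(a+b)c=ac+bc$ for all $a,b,c\in A$; it is \emph{integral} if $1+x=1$ for all $x\in A$. Let $2=\{\bot<\top\}$ be the two-element lattice, regarded as a rig with $+=\vee$ and $\cdot=\wedge$. A rig $A$ is \emph{really local} if the map $A\to 2$ that sends $x$ to $\top$ exactly when $x$ is invertible is a morphism of rigs. For $S\subseteq A$, a \emph{localization} $A\to A[S^{-1}]$ is a morphism to an integral rig that is universal, among morphisms from $A$ to integral rigs, for inverting all elements of $S$. The \emph{spectrum} $\sigma A$ is the set of rig morphisms $p:A\to 2$ with the topology that has the sets $\sigma(x)=\{p\mid p(x)=\top\}$, $x\in A$, as a basis. \textbf{Corollary.} Let $A$ be an integral rig. Then $\sigma A$ is a spectral space, and there is a local homeomorphism $\pi:E\to\sigma A$, each of whose fibers $E_p=\pi^{-1}(p)$ carries a rig structure, such that the zero and unit sections $\sigma A\to E$ and the fiberwise addition and multiplication $E\times_{\sigma A}E\to E$ are continuous, together with an isomorphism from $A$ onto the rig of global continuous sections of $\pi$ (with pointwise operations), such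 that for every $p\in\sigma A$: (1) the fiber $E_p$ is a really local integral rig; (2) the map $A\to E_p$ that sends $a$ to the value at $p$ of the section corresponding to $a$ is a localization $A\to A[(p^{-1}\top)^{-1}]$ of $A$ at $p^{-1}\top=\{x\in A\mid p(x)=\top\}$. -/

import Mathlib

universe u v

namespace IntegralRig

/-- A rig (commutative semiring) is integral if `1 + x = 1` holds in it. -/
def IsIntegral (A : Type u) [CommSemiring A] : Prop :=
  ∀ x : A, 1 + x = 1

/-- The two-element lattice `2 = {⊥ < ⊤}`. -/
inductive Two : Type
  | bot : Two
  | top : Two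

namespace Two

/-- Join. -/
def join : Two → Two → Two
  | bot, y => y
  | top, _ => top

/-- Meet. -/
def meet : Two → Two → Two
  | bot, _ => bot
  | top, y => y

instance : Zero Two := ⟨bot⟩
instance : One Two := ⟨top⟩
instance : Add Two := ⟨join⟩
instance : Mul Two := ⟨meet⟩

/-- `2` as a rig: addition is join, multiplication is meet, `0 = ⊥` and `1 = ⊤`. -/
instance : CommSemiring Two where
  nsmul := nsmulRec
  add_assoc := by rintro (_ | _) (_ | _) (_ | _) <;> rfl
  zero_add := by rintro (_ | _) <;> rfl
  add_zero := by rintro (_ | _) <;> rfl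
  add_comm := by rintro (_ | _) (_ | _) <;> rfl
  mul_assoc := by rintro (_ | _) (_ | _) (_ | _) <;> rfl
  one_mul := by rintro (_ | _) <;> rfl
  mul_one := by rintro (_ | _) <;> rfl
  mul_comm := by rintro (_ | _) (_ | _) <;> rfl
  zero_mul := by rintro (_ | _) <;> rfl
  mul_zero := by rintro (_ | _) <;> rfl
  left_distrib := by rintro (_ | _) (_ | _) (_ | _) <;> rfl
  right_distrib := by rintro (_ | _) (_ | _) (_ | _) <;> rfl

end Two

/-- The spectrum of a rig `A`: its points are the rig morphisms `A → 2`. -/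
def Spectrum (A : Type u) [CommSemiring A] : Type u := A →+* Two

/-- The subset `p⁻¹ ⊤` of `A`, for a point `p : A → 2`. -/
def Spectrum.preimageTop {A : Type u} [CommSemiring A] (p : Spectrum A) : Set A :=
  {x | (show A →+* Two from p) x = Two.top}

/-- The basic open `σ(x) = {p | p x = ⊤}`. -/
def basicOpen {A : Type u} [CommSemiring A] (x : A) : Set (Spectrum A) :=
  {p | x ∈ p.preimageTop}

/-- The topology whose basic open sets are the `σ(x)`. -/
instance (A : Type u) [CommSemiring A] : TopologicalSpace (Spectrum A) :=
  TopologicalSpace.generateFrom (Set.range (basicOpen (A := A)))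

/-- The sets `σ(x)` form a basis of the topology of the spectrum. -/
theorem isTopologicalBasis_basicOpen (A : Type u) [CommSemiring A] :
    TopologicalSpace.IsTopologicalBasis (Set.range (basicOpen (A := A))) where
  exists_subset_inter := by
    rintro _ ⟨x, rfl⟩ _ ⟨y, rfl⟩ p ⟨hx, hy⟩
    have key : ∀ a b : Two, a * b = Two.top ↔ a = Two.top ∧ b = Two.top := by
      rintro (_ | _) (_ | _) <;> simp [HMul.hMul, Mul.mul, Two.meet]
    have h : ∀ q : Spectrum A,
        q ∈ basicOpen (x * y) ↔ q ∈ basicOpen x ∧ q ∈ basicOpen y := fun q => by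
      change (show A →+* Two from q) (x * y) = Two.top ↔ _
      rw [map_mul]
      exact key _ _
    exact ⟨_, ⟨x * y, rfl⟩, (h p).2 ⟨hx, hy⟩, fun q hq => (h q).1 hq⟩
  sUnion_eq := Set.eq_univ_of_forall fun p =>
    ⟨basicOpen 1, ⟨1, rfl⟩, map_one (show A →+* Two from p)⟩
  eq_generateFrom := rfl

/-- A rig `A` (in sets) is really local if the characteristic map of its subset of invertible
elements, with values in the truth values `2`, is a morphism of rigs. -/
def IsReallyLocal (A : Type u) [CommSemiring A] : Prop :=
  ∃ ι : A →+* Two, ∀ x : A, ι x = Two.top ↔ IsUnit x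

/-- `φ : A → B` is a localization `A → A[S⁻¹]`: a solution, in the category of integral rigs, to
the universal problem of inverting all the elements of `S`. -/
structure IsLocalizationAt {A B : Type u} [CommSemiring A] [CommSemiring B]
    (S : Set A) (φ : A →+* B) : Prop where
  isIntegral : IsIntegral B
  isUnit : ∀ s ∈ S, IsUnit (φ s)
  existsUnique : ∀ (C : Type u) [CommSemiring C], IsIntegral C →
    ∀ f : A →+* C, (∀ s ∈ S, IsUnit (f s)) → ∃! g : B →+* C, g.comp φ = f

/-- The fiber product `E ×_X E` of the total space `E = Σ x, F x` with itself over `X`, presented as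
the set of triples consisting of a point `x` and two elements of the fiber over `x`. -/
structure FiberProduct {X : Type u} (F : X → Type v) : Type (max u v) where
  pt : X
  fst : F pt
  snd : F pt

/-- The inclusion `E ×_X E → E × E`. -/
def FiberProduct.incl {X : Type u} {F : X → Type v} (q : FiberProduct F) :
    (Σ x, F x) × (Σ x, F x) :=
  (⟨q.pt, q.fst⟩, ⟨q.pt, q.snd⟩)

/-- The fiber product has the topology induced by its inclusion in the product. -/
instance {X : Type u} (F : X → Type v) [TopologicalSpace (Σ x, F x)] :
    TopologicalSpace (FiberProduct F) :=
  TopologicalSpace.induced FiberProduct.incl inferInstance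

/-- A local homeomorphism over `X` with a rig structure on its fibers, varying continuously; in
other words, a rig object in the category of local homeomorphisms over `X`. The total space is
presented as the disjoint union `Σ x, Fiber x` of the fibers, with a topology of its own. -/
structure RigLocalHomeo (X : Type u) [TopologicalSpace X] where
  /-- The fibers. -/
  Fiber : X → Type v
  /-- The rig structure of the fibers. -/
  [fiberRig : ∀ x, CommSemiring (Fiber x)]
  /-- The topology of the total space. -/
  [totalTopology : TopologicalSpace (Σ x, Fiber x)]
  isLocalHomeomorph : IsLocalHomeomorph (Sigma.fst : (Σ x, Fiber x) → X)
  continuous_zero : Continuous fun x : X => (⟨x, 0⟩ : Σ x, Fiber x)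
  continuous_one : Continuous fun x : X => (⟨x, 1⟩ : Σ x, Fiber x)
  continuous_add : Continuous fun q : FiberProduct Fiber =>
    (⟨q.pt, q.fst + q.snd⟩ : Σ x, Fiber x)
  continuous_mul : Continuous fun q : FiberProduct Fiber =>
    (⟨q.pt, q.fst * q.snd⟩ : Σ x, Fiber x)

attribute [instance] RigLocalHomeo.fiberRig RigLocalHomeo.totalTopology

namespace RigLocalHomeo

variable {X : Type u} [TopologicalSpace X] (E : RigLocalHomeo.{u, v} X)

theorem continuous_pair {s t : ∀ x, E.Fiber x}
    (hs : Continuous fun x : X => (⟨x, s x⟩ : Σ x, E.Fiber x))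
    (ht : Continuous fun x : X => (⟨x, t x⟩ : Σ x, E.Fiber x)) :
    Continuous fun x : X => (⟨x, s x, t x⟩ : FiberProduct E.Fiber) :=
  continuous_induced_rng.2 (hs.prodMk ht)

/-- The rig of global sections: the continuous sections of the projection, with the pointwise
operations. -/
def globalSections : Subsemiring (∀ x, E.Fiber x) where
  carrier := {s | Continuous fun x : X => (⟨x, s x⟩ : Σ x, E.Fiber x)}
  zero_mem' := E.continuous_zero
  one_mem' := E.continuous_one
  add_mem' := fun hs ht => E.continuous_add.comp (E.continuous_pair hs ht)
  mul_mem' := fun hs ht => E.continuous_mul.comp (E.continuous_pair hs ht)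

/-- Evaluation of global sections at a point. -/
def eval (x : X) : E.globalSections →+* E.Fiber x :=
  (Pi.evalRingHom E.Fiber x).comp E.globalSections.subtype

end RigLocalHomeo

end IntegralRig

open Topology TopologicalSpace

namespace IntegralRig

/-! An integral rig is additively idempotent, hence ordered by `a ≤ b ↔ a + b = b`, with `1` as top
element; so products lie below their factors. A unit of an integral rig equals `1`, so localizing at
`p⁻¹ ⊤` needs no fractions: it is a quotient of `A`, by `localCon`.

The crux is `exists_pow_mul_le`: if near every point of `σ(x)` some `s` gives `s * a ≤ b`, then `x ^
n * a ≤ b` for some `n`. It combines compactness of `σ(x)` with prime separation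
(`exists_mem_notMem`). Taking `x = 1` shows that an element is determined by its germs. On overlaps
it makes local representatives `a p` of a section compatible up to powers, so that a finite sum of
terms `x p ^ M * a p` represents the section globally. -/

theorem Two.mul_eq_top {a b : Two} : a * b = Two.top ↔ a = Two.top ∧ b = Two.top := by
  rcases a with _ | _ <;> rcases b with _ | _ <;>
    simp [HMul.hMul, Mul.mul, Two.meet]

theorem Two.add_eq_top {a b : Two} : a + b = Two.top ↔ a = Two.top ∨ b = Two.top := by
  rcases a with _ | _ <;> rcases b with _ | _ <;>
    simp [HAdd.hAdd, Add.add, Two.join]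

theorem Two.eq_of_eq_top_iff {a b : Two} (h : a = Two.top ↔ b = Two.top) : a = b := by
  rcases a with _ | _ <;> rcases b with _ | _ <;> simp_all

/-! ### The spectrum is a spectral space -/

namespace Spectrum

section CommSemiring

variable {A : Type u} [CommSemiring A]

theorem ext {p q : Spectrum A} (h : ∀ x, x ∈ p.preimageTop ↔ x ∈ q.preimageTop) : p = q :=
  RingHom.ext (α := A) (β := Two) fun x => Two.eq_of_eq_top_iff (h x)

theorem one_mem (p : Spectrum A) : 1 ∈ p.preimageTop :=
  map_one (show A →+* Two from p)

theorem zero_notMem (p : Spectrum A) : 0 ∉ p.preimageTop := fun h => by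
  have h' : (0 : Two) = Two.top := (map_zero (show A →+* Two from p)).symm.trans h
  cases h'

theorem mul_mem_iff (p : Spectrum A) {x y : A} :
    x * y ∈ p.preimageTop ↔ x ∈ p.preimageTop ∧ y ∈ p.preimageTop := by
  change (show A →+* Two from p) (x * y) = Two.top ↔ _
  rw [map_mul]
  exact Two.mul_eq_top

theorem add_mem_iff (p : Spectrum A) {x y : A} :
    x + y ∈ p.preimageTop ↔ x ∈ p.preimageTop ∨ y ∈ p.preimageTop := by
  change (show A →+* Two from p) (x + y) = Two.top ↔ _
  rw [map_add]
  exact Two.add_eq_top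

theorem pow_mem (p : Spectrum A) {x : A} (hx : x ∈ p.preimageTop) (n : ℕ) :
    x ^ n ∈ p.preimageTop := by
  induction n with
  | zero => simpa using p.one_mem
  | succ n ih => exact pow_succ x n ▸ p.mul_mem_iff.2 ⟨ih, hx⟩

theorem sum_mem_iff (p : Spectrum A) {ι : Type*} (t : Finset ι) (f : ι → A) :
    ∑ i ∈ t, f i ∈ p.preimageTop ↔ ∃ i ∈ t, f i ∈ p.preimageTop := by
  classical
  induction t using Finset.induction_on with
  | empty => simpa using p.zero_notMem
  | insert i t hi ih => rw [Finset.sum_insert hi, add_mem_iff, ih]; simp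

open Classical in
/-- The point of the spectrum whose preimage of `⊤` is the set of elements satisfying `P`. -/
noncomputable def ofPred (P : A → Prop) (one : P 1) (zero : ¬ P 0)
    (mul : ∀ x y, P (x * y) ↔ P x ∧ P y) (add : ∀ x y, P (x + y) ↔ P x ∨ P y) :
    Spectrum A :=
  RingHom.mk (α := A) (β := Two)
    { toFun := fun x => if P x then Two.top else Two.bot
      map_one' := if_pos one
      map_mul' := fun x y => Two.eq_of_eq_top_iff (by
        rw [Two.mul_eq_top]; simp only [mul, ite_eq_left_iff, reduceCtorEq]; tauto) }
    (if_neg zero)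
    (fun x y => Two.eq_of_eq_top_iff (by
      rw [Two.add_eq_top]; simp only [add, ite_eq_left_iff, reduceCtorEq]; tauto))

theorem mem_preimageTop_ofPred {P : A → Prop} {one zero mul add} {x : A} :
    x ∈ (ofPred P one zero mul add).preimageTop ↔ P x := by
  classical
  change (if P x then Two.top else Two.bot) = Two.top ↔ _
  simp

theorem ofPred_mem_basicOpen {P : A → Prop} {one zero mul add} {x : A} :
    ofPred P one zero mul add ∈ basicOpen x ↔ P x :=
  mem_preimageTop_ofPred

theorem isOpen_basicOpen (x : A) : IsOpen (basicOpen x) :=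
  (isTopologicalBasis_basicOpen A).isOpen ⟨x, rfl⟩

theorem basicOpen_mul (x y : A) : basicOpen (x * y) = basicOpen x ∩ basicOpen y :=
  Set.ext fun p => p.mul_mem_iff

theorem basicOpen_one : basicOpen (1 : A) = Set.univ :=
  Set.eq_univ_of_forall one_mem

/-- An ultrafilter `U` containing `σ(x)` converges to the point `y ↦ (σ(y) ∈ U)`; the behaviour of
ultrafilters on intersections and unions makes this a rig morphism. -/
theorem isCompact_basicOpen (x : A) : IsCompact (basicOpen x) := by
  rw [isCompact_iff_ultrafilter_le_nhds]
  intro U hU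
  have hmul : ∀ y z : A, basicOpen (y * z) ∈ U ↔ basicOpen y ∈ U ∧ basicOpen z ∈ U :=
    fun y z => by rw [basicOpen_mul]; exact Filter.inter_mem_iff
  have hadd : ∀ y z : A, basicOpen (y + z) ∈ U ↔ basicOpen y ∈ U ∨ basicOpen z ∈ U :=
    fun y z => by
      have : basicOpen (y + z) = basicOpen y ∪ basicOpen z := Set.ext fun p => p.add_mem_iff
      rw [this, Ultrafilter.union_mem_iff]
  have hzero : basicOpen (0 : A) ∉ U := by
    have : basicOpen (0 : A) = ∅ := Set.eq_empty_of_forall_notMem zero_notMem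
    rw [this]
    exact U.empty_notMem
  have hone : basicOpen (1 : A) ∈ U := by
    rw [basicOpen_one]
    exact Filter.univ_mem
  refine ⟨ofPred (fun y => basicOpen y ∈ U) hone hzero hmul hadd,
    mem_preimageTop_ofPred.2 (Filter.le_principal_iff.1 hU), ?_⟩
  refine ((isTopologicalBasis_basicOpen A).nhds_hasBasis.ge_iff).2 ?_
  rintro _ ⟨⟨y, rfl⟩, hy⟩
  have h := ofPred_mem_basicOpen.1 hy
  exact h

/-- The generic point of `C` sends `y` to `⊤` exactly when `σ(y)` meets `C`; irreducibility gives
multiplicativity. -/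
theorem quasiSober : QuasiSober (Spectrum A) where
  sober {C} hC hC' := by
    let P : A → Prop := fun y => (C ∩ basicOpen y).Nonempty
    have hone : P 1 := by
      simpa only [P, basicOpen_one, Set.inter_univ] using hC.nonempty
    have hzero : ¬ P 0 := fun ⟨p, _, hp⟩ => p.zero_notMem hp
    have hmul : ∀ y z, P (y * z) ↔ P y ∧ P z := by
      intro y z
      simp only [P, basicOpen_mul]
      exact ⟨fun ⟨p, hp, hyz⟩ => ⟨⟨p, hp, hyz.1⟩, ⟨p, hp, hyz.2⟩⟩,
        fun ⟨hy, hz⟩ => hC.2 _ _ (isOpen_basicOpen y) (isOpen_basicOpen z) hy hz⟩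
    have hadd : ∀ y z, P (y + z) ↔ P y ∨ P z := by
      intro y z
      constructor
      · rintro ⟨p, hp, hyz⟩
        exact (p.add_mem_iff.1 hyz).imp (fun h => ⟨p, hp, h⟩) (fun h => ⟨p, hp, h⟩)
      · rintro (⟨p, hp, h⟩ | ⟨p, hp, h⟩)
        · exact ⟨p, hp, p.add_mem_iff.2 (Or.inl h)⟩
        · exact ⟨p, hp, p.add_mem_iff.2 (Or.inr h)⟩
    refine ⟨ofPred P hone hzero hmul hadd, ?_⟩
    refine Set.Subset.antisymm (hC'.closure_subset_iff.2 (Set.singleton_subset_iff.2 ?_)) ?_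
    · refine hC'.closure_subset ((isTopologicalBasis_basicOpen A).mem_closure_iff.2 ?_)
      rintro _ ⟨y, rfl⟩ hy
      rw [Set.inter_comm]
      have h := ofPred_mem_basicOpen.1 hy
      exact h
    · intro q hq
      rw [(isTopologicalBasis_basicOpen A).mem_closure_iff]
      rintro _ ⟨y, rfl⟩ hy
      have hPy : P y := ⟨q, hq, hy⟩
      exact ⟨_, ofPred_mem_basicOpen.2 hPy, rfl⟩

theorem t0Space : T0Space (Spectrum A) where
  t0 _ _ h := ext fun x => h.mem_open_iff (isOpen_basicOpen x)

theorem spectralSpace : SpectralSpace (Spectrum A) where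
  toT0Space := t0Space
  toCompactSpace := ⟨basicOpen_one (A := A) ▸ isCompact_basicOpen 1⟩
  toQuasiSober := quasiSober
  toPrespectralSpace :=
    .of_isTopologicalBasis' (isTopologicalBasis_basicOpen A) isCompact_basicOpen
  toQuasiSeparatedSpace := by
    refine .of_isTopologicalBasis (isTopologicalBasis_basicOpen A) ?_
    intro x y
    exact basicOpen_mul x y ▸ isCompact_basicOpen _

end CommSemiring

end Spectrum

theorem IsIntegral.eq_one_of_isUnit {A : Type u} [CommSemiring A] (hA : IsIntegral A) {x : A}
    (hx : IsUnit x) : x = 1 := by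
  obtain ⟨y, hy⟩ := hx.exists_right_inv
  calc x = x * (1 + y) := by rw [hA, mul_one]
    _ = 1 := by rw [mul_add, mul_one, hy, add_comm, hA]

/-! ### Order and prime separation -/

namespace Spectrum

variable {A : Type u} [IdemCommSemiring A]

theorem le_one_of_isIntegral (hA : IsIntegral A) (x : A) : x ≤ 1 :=
  add_eq_left_iff_le.1 (hA x)

theorem mul_le_left_of_isIntegral (hA : IsIntegral A) (x y : A) : x * y ≤ x :=
  mul_le_of_le_one_right' (le_one_of_isIntegral hA y)

theorem mul_le_right_of_isIntegral (hA : IsIntegral A) (x y : A) : x * y ≤ y :=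
  mul_le_of_le_one_left' (le_one_of_isIntegral hA x)

theorem mem_of_le (p : Spectrum A) {x y : A} (hx : x ∈ p.preimageTop) (h : x ≤ y) :
    y ∈ p.preimageTop :=
  h.add_eq_right ▸ p.add_mem_iff.2 (Or.inl hx)

/-- The point is the complement of an ideal containing `y` and maximal among those that miss every
element above a power of `x`; such an ideal is prime. -/
theorem exists_mem_notMem (hA : IsIntegral A) {x y : A} (h : ∀ n : ℕ, ¬ x ^ n ≤ y) :
    ∃ p : Spectrum A, x ∈ p.preimageTop ∧ y ∉ p.preimageTop := by
  let S : Submonoid A :=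
    { carrier := {z | ∃ n : ℕ, x ^ n ≤ z}
      one_mem' := ⟨0, (pow_zero x).le⟩
      mul_mem' := by
        rintro a b ⟨n, hn⟩ ⟨m, hm⟩
        exact ⟨n + m, pow_add x n m ▸ mul_le_mul' hn hm⟩ }
  have hS : ∀ {z w}, z ∈ S → z ≤ w → w ∈ S := fun ⟨n, hn⟩ h => ⟨n, hn.trans h⟩
  have hy : Disjoint ((Ideal.span {y} : Ideal A) : Set A) S := by
    rw [Set.disjoint_left]
    rintro z hz ⟨n, hn⟩
    obtain ⟨c, rfl⟩ := Ideal.mem_span_singleton'.1 hz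
    exact h n (hn.trans (mul_le_right_of_isIntegral hA c y))
  obtain ⟨P, hyP, hP⟩ := zorn_le_nonempty₀ {P : Ideal A | Disjoint (P : Set A) S}
    (fun c hc hc' I hI => ⟨sSup c, Set.disjoint_left.mpr fun z hz => by
      obtain ⟨J, hJ, hzJ⟩ := (Submodule.mem_sSup_of_directed ⟨I, hI⟩ hc'.directedOn).1 hz
      exact Set.disjoint_left.1 (hc hJ) hzJ, fun _ => le_sSup⟩) _ hy
  have prime : P.IsPrime :=
    Ideal.isPrime_of_maximally_disjoint _ _ hP.1 (fun _ => hP.not_prop_of_gt)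
  -- Additivity of the point requires `P` to be a lower set. Its down-closure `Q` still misses the
  -- upper set `S`, so maximality forces `Q ≤ P`.
  let Q : Ideal A :=
    { carrier := {z | ∃ w ∈ P, z ≤ w}
      zero_mem' := ⟨0, P.zero_mem, le_rfl⟩
      add_mem' := by
        rintro a b ⟨c, hc, hac⟩ ⟨d, hd, hbd⟩
        exact ⟨c + d, P.add_mem hc hd, add_le_add hac hbd⟩
      smul_mem' := by
        rintro a b ⟨c, hc, hbc⟩
        exact ⟨c, hc, (mul_le_right_of_isIntegral hA a b).trans hbc⟩ }
  have hQ : Disjoint (Q : Set A) S := Set.disjoint_left.2 fun z ⟨w, hw, hzw⟩ hz =>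
    Set.disjoint_left.1 hP.1 hw (hS hz hzw)
  have hQP : Q ≤ P := hP.2 hQ fun z hz => ⟨z, hz, le_rfl⟩
  have lower : ∀ {z w}, z ≤ w → w ∈ P → z ∈ P := fun hzw hw => hQP ⟨_, hw, hzw⟩
  refine ⟨ofPred (fun z => z ∉ P) (fun h1 => Set.disjoint_left.1 hP.1 h1 S.one_mem)
    (fun h0 => h0 P.zero_mem) (fun a b => ?_) (fun a b => ?_), ?_, ?_⟩
  · rw [prime.mul_mem_iff_mem_or_mem, not_or]
  · rw [← not_and_or, not_iff_not]
    exact ⟨fun hab => ⟨lower le_self_add hab,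
      lower le_add_self hab⟩, fun hab => P.add_mem hab.1 hab.2⟩
  · exact mem_preimageTop_ofPred.2 fun hx =>
      Set.disjoint_left.1 hP.1 hx ⟨1, (pow_one x).le⟩
  · exact fun hy => mem_preimageTop_ofPred.1 hy (hyP (Ideal.mem_span_singleton_self y))

theorem exists_pow_le_of_basicOpen_subset (hA : IsIntegral A) {x y : A}
    (h : basicOpen x ⊆ basicOpen y) : ∃ n : ℕ, x ^ n ≤ y := by
  by_contra! hn
  obtain ⟨p, hx, hy⟩ := exists_mem_notMem hA hn
  exact hy (h hx)

theorem exists_finset_basicOpen_cover {x : A} {y : Spectrum A → A}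
    (h : ∀ p ∈ basicOpen x, p ∈ basicOpen (y p)) :
    ∃ t : Finset (Spectrum A), (∀ p ∈ t, p ∈ basicOpen x) ∧
      basicOpen x ⊆ basicOpen (∑ p ∈ t, y p) := by
  obtain ⟨t, ht, hxt⟩ := (isCompact_basicOpen x).elim_nhds_subcover (fun p => basicOpen (y p))
    fun p hp => (isOpen_basicOpen _).mem_nhds (h p hp)
  refine ⟨t, ht, fun q hq => (q.sum_mem_iff t y).2 ?_⟩
  obtain ⟨p, hp, h⟩ := Set.mem_iUnion₂.1 (hxt hq)
  exact ⟨p, hp, h⟩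

theorem sum_le {ι : Type*} {t : Finset ι} {f : ι → A} {b : A} (h : ∀ i ∈ t, f i ≤ b) :
    ∑ i ∈ t, f i ≤ b := by
  classical
  induction t using Finset.induction_on with
  | empty => exact zero_le
  | insert i t hi ih =>
    rw [Finset.sum_insert hi]
    exact add_le (h i (by simp)) (ih fun j hj => h j (by simp [hj]))

theorem exists_pow_mul_le (hA : IsIntegral A) {x a b : A}
    (h : ∀ p ∈ basicOpen x, ∃ s ∈ p.preimageTop, s * a ≤ b) : ∃ n : ℕ, x ^ n * a ≤ b := by
  choose! s hs hsab using h
  obtain ⟨t, ht, hxt⟩ := exists_finset_basicOpen_cover hs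
  obtain ⟨n, hn⟩ := exists_pow_le_of_basicOpen_subset hA hxt
  refine ⟨n, (mul_le_mul_left hn a).trans ?_⟩
  rw [Finset.sum_mul]
  exact sum_le fun p hp => hsab p (ht p hp)

/-! ### Localizations at points -/

/-- The congruence of the localization of `A` at `p⁻¹ ⊤`: it identifies `a` and `b` if
`s * a ≤ b` and `s * b ≤ a` for some `s` in `p⁻¹ ⊤`. -/
def localCon (p : Spectrum A) (hA : IsIntegral A) : RingCon A where
  r a b := ∃ s ∈ p.preimageTop, s * a ≤ b ∧ s * b ≤ a
  iseqv :=
    { refl := fun a => ⟨1, p.one_mem, (one_mul a).le, (one_mul a).le⟩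
      symm := fun ⟨s, hs, h, h'⟩ => ⟨s, hs, h', h⟩
      trans := by
        rintro a b c ⟨s, hs, hab, hba⟩ ⟨t, ht, hbc, hcb⟩
        refine ⟨s * t, p.mul_mem_iff.2 ⟨hs, ht⟩, ?_, ?_⟩
        · calc s * t * a = t * (s * a) := by ring
            _ ≤ t * b := mul_le_mul_right hab t
            _ ≤ c := hbc
        · calc s * t * c = s * (t * c) := by ring
            _ ≤ s * b := mul_le_mul_right hcb s
            _ ≤ a := hba }
  add' := by
    rintro a b c d ⟨s, hs, hab, hba⟩ ⟨t, ht, hcd, hdc⟩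
    have hl := mul_le_left_of_isIntegral hA s t
    have hr := mul_le_right_of_isIntegral hA s t
    refine ⟨s * t, p.mul_mem_iff.2 ⟨hs, ht⟩, ?_, ?_⟩ <;> rw [mul_add]
    · exact add_le_add ((mul_le_mul_left hl a).trans hab) ((mul_le_mul_left hr c).trans hcd)
    · exact add_le_add ((mul_le_mul_left hl b).trans hba) ((mul_le_mul_left hr d).trans hdc)
  mul' := by
    rintro a b c d ⟨s, hs, hab, hba⟩ ⟨t, ht, hcd, hdc⟩
    refine ⟨s * t, p.mul_mem_iff.2 ⟨hs, ht⟩, ?_, ?_⟩ <;> rw [mul_mul_mul_comm]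
    · exact mul_le_mul' hab hcd
    · exact mul_le_mul' hba hdc

variable (hA : IsIntegral A)

/-- The localization of `A` at `p⁻¹ ⊤`. -/
abbrev Stalk (p : Spectrum A) : Type u := (p.localCon hA).Quotient

/-- The localization morphism at `p⁻¹ ⊤`. -/
abbrev toStalk (p : Spectrum A) : A →+* p.Stalk hA := (p.localCon hA).mk'

theorem toStalk_eq_iff {p : Spectrum A} {a b : A} :
    p.toStalk hA a = p.toStalk hA b ↔ ∃ s ∈ p.preimageTop, s * a ≤ b ∧ s * b ≤ a :=
  RingCon.eq _

theorem toStalk_surjective (p : Spectrum A) : Function.Surjective (p.toStalk hA) :=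
  RingCon.mk'_surjective _

theorem toStalk_eq_one {p : Spectrum A} {s : A} (hs : s ∈ p.preimageTop) :
    p.toStalk hA s = 1 := by
  rw [← map_one (p.toStalk hA), toStalk_eq_iff]
  exact ⟨s, hs, le_one_of_isIntegral hA _, (mul_one s).le⟩

theorem isIntegral_stalk (p : Spectrum A) : IsIntegral (p.Stalk hA) := by
  intro x
  obtain ⟨a, rfl⟩ := p.toStalk_surjective hA x
  rw [← map_one (p.toStalk hA), ← map_add, hA]

/-- The morphism `p` itself descends to the quotient, where every element over `⊤` has become `1`.
-/
theorem isReallyLocal_stalk (p : Spectrum A) : IsReallyLocal (p.Stalk hA) := by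
  have ker : p.localCon hA ≤ RingCon.ker (show A →+* Two from p) := by
    rintro a b ⟨s, hs, hab, hba⟩
    refine Two.eq_of_eq_top_iff ⟨fun h => ?_, fun h => ?_⟩
    · exact p.mem_of_le (p.mul_mem_iff.2 ⟨hs, h⟩) hab
    · exact p.mem_of_le (p.mul_mem_iff.2 ⟨hs, h⟩) hba
  refine ⟨(p.localCon hA).lift (show A →+* Two from p) ker, fun x => ⟨fun h => ?_, fun h => ?_⟩⟩
  · obtain ⟨a, rfl⟩ := p.toStalk_surjective hA x
    have ha : a ∈ p.preimageTop := h
    rw [toStalk_eq_one hA ha]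
    exact isUnit_one
  · rw [(isIntegral_stalk hA p).eq_one_of_isUnit h, map_one]
    rfl

theorem isLocalizationAt_toStalk (p : Spectrum A) :
    IsLocalizationAt p.preimageTop (p.toStalk hA) where
  isIntegral := isIntegral_stalk hA p
  isUnit s hs := toStalk_eq_one hA hs ▸ isUnit_one
  existsUnique C _ hC f hf := by
    -- Since `f s = 1`, this is `f a ≤ f b`, spelled additively because `C` carries no order.
    have key : ∀ {s a b : A}, s ∈ p.preimageTop → s * a ≤ b → f a + f b = f b := by
      intro s a b hs hab
      rw [← one_mul (f a), ← hC.eq_one_of_isUnit (hf s hs), ← map_mul, ← map_add,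
        hab.add_eq_right]
    have ker : p.localCon hA ≤ RingCon.ker f := by
      rintro a b ⟨s, hs, hab, hba⟩
      change f a = f b
      rw [← key hs hab, add_comm, key hs hba]
    exact ⟨(p.localCon hA).lift f ker, rfl, fun g hg => RingCon.lift_unique ker g hg⟩

/-! ### The total space of the sheaf -/

/-- The section of the sheaf of localizations given by an element of `A`. -/
def germ (a : A) (p : Spectrum A) : Σ p : Spectrum A, p.Stalk hA := ⟨p, p.toStalk hA a⟩

/-- The finest topology on the disjoint union of the localizations that makes the sections given
by the elements of `A` continuous. -/
instance totalTopology : TopologicalSpace (Σ p : Spectrum A, p.Stalk hA) :=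
  ⨆ a : A, TopologicalSpace.coinduced (germ hA a) inferInstance

theorem isOpen_total_iff {U : Set (Σ p : Spectrum A, p.Stalk hA)} :
    IsOpen U ↔ ∀ a : A, IsOpen (germ hA a ⁻¹' U) := by
  simp only [isOpen_iSup_iff, isOpen_coinduced]

theorem continuous_germ (a : A) : Continuous (germ hA a) :=
  continuous_def.2 fun _ hU => (isOpen_total_iff hA).1 hU a

theorem germ_eq_iff {a b : A} {p q : Spectrum A} :
    germ hA a p = germ hA b q ↔ p = q ∧ p.toStalk hA a = p.toStalk hA b := by
  constructor
  · intro h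
    obtain rfl : p = q := congrArg Sigma.fst h
    exact ⟨rfl, eq_of_heq (Sigma.mk.inj h).2⟩
  · rintro ⟨rfl, h⟩
    exact congrArg (Sigma.mk p) h

theorem exists_germ_eq (e : Σ p : Spectrum A, p.Stalk hA) : ∃ a, germ hA a e.1 = e := by
  obtain ⟨p, x⟩ := e
  obtain ⟨a, rfl⟩ := p.toStalk_surjective hA x
  exact ⟨a, rfl⟩

theorem isOpen_setOf_toStalk_eq (a b : A) :
    IsOpen {p : Spectrum A | p.toStalk hA a = p.toStalk hA b} := by
  rw [isOpen_iff_mem_nhds]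
  intro p hp
  obtain ⟨s, hs, h⟩ := (toStalk_eq_iff hA).1 hp
  filter_upwards [(isOpen_basicOpen s).mem_nhds hs] with q hq
  exact (toStalk_eq_iff hA).2 ⟨s, hq, h⟩

/-- Two germs that agree at a point agree on a basic open around it, so equality loci are open. -/
theorem isOpenMap_germ (a : A) : IsOpenMap (germ hA a) := by
  intro V hV
  rw [isOpen_total_iff]
  intro b
  convert hV.inter (isOpen_setOf_toStalk_eq hA a b) using 1
  ext p
  simp only [Set.mem_preimage, Set.mem_image, germ_eq_iff]
  constructor
  · rintro ⟨q, hq, rfl, h⟩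
    exact ⟨hq, h⟩
  · rintro ⟨hp, h⟩
    exact ⟨p, hp, rfl, h⟩

theorem isOpenEmbedding_germ (a : A) : IsOpenEmbedding (germ hA a) :=
  .of_continuous_injective_isOpenMap (continuous_germ hA a)
    (fun _ _ h => ((germ_eq_iff hA).1 h).1) (isOpenMap_germ hA a)

theorem continuous_proj :
    Continuous (Sigma.fst : (Σ p : Spectrum A, p.Stalk hA) → Spectrum A) :=
  continuous_def.2 fun _ hU => (isOpen_total_iff hA).2 fun _ => hU

theorem isLocalHomeomorph_proj :
    IsLocalHomeomorph (Sigma.fst : (Σ p : Spectrum A, p.Stalk hA) → Spectrum A) := by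
  refine IsLocalHomeomorph.mk _ fun e => ?_
  obtain ⟨a, ha⟩ := exists_germ_eq hA e
  have : Nonempty (Spectrum A) := ⟨e.1⟩
  refine ⟨((isOpenEmbedding_germ hA a).toOpenPartialHomeomorph _).symm, ?_, ?_⟩
  · simpa using ⟨e.1, ha⟩
  · intro e' he'
    obtain ⟨q, rfl⟩ : e' ∈ Set.range (germ hA a) := by simpa using he'
    exact ((isOpenEmbedding_germ hA a).toOpenPartialHomeomorph_left_inv _).symm

/-- Near a given pair both coordinates stay in the open images of two sections `a` and `b`, where
the operation is the projection followed by the section `op' a b`. -/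
theorem continuous_of_germ {op : ∀ p : Spectrum A, p.Stalk hA → p.Stalk hA → p.Stalk hA}
    {op' : A → A → A}
    (h : ∀ p a b, op p (p.toStalk hA a) (p.toStalk hA b) = p.toStalk hA (op' a b)) :
    Continuous fun q : FiberProduct fun p : Spectrum A => p.Stalk hA =>
      (⟨q.pt, op q.pt q.fst q.snd⟩ : Σ p : Spectrum A, p.Stalk hA) := by
  rw [continuous_iff_continuousAt]
  intro q
  have hincl : Continuous
      (FiberProduct.incl : FiberProduct (fun p : Spectrum A => p.Stalk hA) → _) :=
    continuous_induced_dom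
  obtain ⟨a, ha⟩ := exists_germ_eq hA q.incl.1
  obtain ⟨b, hb⟩ := exists_germ_eq hA q.incl.2
  have hpt : Continuous fun q : FiberProduct (fun p : Spectrum A => p.Stalk hA) => q.pt :=
    (continuous_proj hA).comp (continuous_fst.comp hincl)
  refine (((continuous_germ hA (op' a b)).comp hpt).continuousAt).congr ?_
  have ha' := (continuous_fst.comp hincl).continuousAt.preimage_mem_nhds
    ((isOpenEmbedding_germ hA a).isOpen_range.mem_nhds ⟨_, ha⟩)
  have hb' := (continuous_snd.comp hincl).continuousAt.preimage_mem_nhds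
    ((isOpenEmbedding_germ hA b).isOpen_range.mem_nhds ⟨_, hb⟩)
  filter_upwards [ha', hb']
  rintro ⟨p, x, y⟩ ⟨p₁, h₁⟩ ⟨p₂, h₂⟩
  obtain rfl : p₁ = p := congrArg Sigma.fst h₁
  obtain rfl : p₂ = p₁ := congrArg Sigma.fst h₂
  obtain rfl : p₂.toStalk hA a = x := eq_of_heq (Sigma.mk.inj h₁).2
  obtain rfl : p₂.toStalk hA b = y := eq_of_heq (Sigma.mk.inj h₂).2
  exact congrArg (Sigma.mk p₂) (h p₂ a b).symm

/-- The sheaf of localizations of `A` at the points of its spectrum. -/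
def stalks : RigLocalHomeo.{u, u} (Spectrum A) where
  Fiber p := p.Stalk hA
  isLocalHomeomorph := isLocalHomeomorph_proj hA
  continuous_zero := continuous_germ hA 0
  continuous_one := continuous_germ hA 1
  continuous_add := continuous_of_germ hA (op := fun _ x y => x + y) fun p a b =>
    (map_add (p.toStalk hA) a b).symm
  continuous_mul := continuous_of_germ hA (op := fun _ x y => x * y) fun p a b =>
    (map_mul (p.toStalk hA) a b).symm

/-! ### Global sections -/

/-- The morphism from `A` to the global sections of its sheaf of localizations. -/
def toGlobalSections : A →+* (stalks hA).globalSections :=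
  (RingHom.pi fun p : Spectrum A => p.toStalk hA).codRestrict (stalks hA).globalSections fun a => continuous_germ hA a

theorem le_of_toStalk_eq {a b : A} (h : ∀ p : Spectrum A, p.toStalk hA a = p.toStalk hA b) :
    a ≤ b := by
  obtain ⟨n, hn⟩ := exists_pow_mul_le hA (x := 1) (a := a) (b := b) fun p _ => by
    obtain ⟨s, hs, hab, _⟩ := (toStalk_eq_iff hA).1 (h p)
    exact ⟨s, hs, hab⟩
  simpa using hn

theorem toGlobalSections_injective : Function.Injective (toGlobalSections hA) := by
  intro a b h
  have h' : ∀ p : Spectrum A, p.toStalk hA a = p.toStalk hA b := fun p =>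
    congrFun (congrArg Subtype.val h) p
  exact (le_of_toStalk_eq hA h').antisymm (le_of_toStalk_eq hA fun p => (h' p).symm)

theorem exists_basicOpen_toStalk_eq (s : (stalks hA).globalSections) (p : Spectrum A) :
    ∃ x a : A, p ∈ basicOpen x ∧ ∀ q ∈ basicOpen x, s.1 q = q.toStalk hA a := by
  have hs : Continuous fun p : Spectrum A => (⟨p, s.1 p⟩ : Σ p : Spectrum A, p.Stalk hA) := s.2
  obtain ⟨a, ha⟩ := exists_germ_eq hA ⟨p, s.1 p⟩
  obtain ⟨_, ⟨x, rfl⟩, hp, hx⟩ := (isTopologicalBasis_basicOpen A).exists_subset_of_mem_open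
    (Set.mem_preimage.2 (Set.mem_range.2 ⟨p, ha⟩)) ((isOpenEmbedding_germ hA a).isOpen_range.preimage hs)
  refine ⟨x, a, hp, fun q hq => ?_⟩
  obtain ⟨q', hq'⟩ := hx hq
  obtain rfl : q' = q := congrArg Sigma.fst hq'
  exact (eq_of_heq (Sigma.mk.inj hq').2).symm

theorem toGlobalSections_surjective : Function.Surjective (toGlobalSections hA) := by
  intro s
  choose x a hx ha using exists_basicOpen_toStalk_eq hA s
  have hN : ∀ p q : Spectrum A, ∃ n : ℕ, (x p * x q) ^ n * a p ≤ a q := fun p q =>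
    exists_pow_mul_le hA fun r hr => by
      obtain ⟨hp, hq⟩ := r.mul_mem_iff.1 hr
      obtain ⟨s, hs, h, _⟩ := (toStalk_eq_iff hA).1 ((ha p r hp).symm.trans (ha q r hq))
      exact ⟨s, hs, h⟩
  choose N hN using hN
  obtain ⟨t, -, ht⟩ := exists_finset_basicOpen_cover (x := (1 : A)) (y := x) fun p _ => hx p
  -- A common exponent for the finite cover; enlarging exponents only decreases powers.
  obtain ⟨M, hM⟩ : ∃ M : ℕ, ∀ p ∈ t, ∀ q ∈ t, N p q ≤ M :=
    ⟨t.sup fun p => t.sup (N p), fun p hp q hq =>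
      (Finset.le_sup (f := N p) hq).trans (Finset.le_sup (f := fun p => t.sup (N p)) hp)⟩
  have hglue : ∀ p ∈ t, ∀ q ∈ t, x q ^ M * (x p ^ M * a p) ≤ a q := by
    intro p hp q hq
    have hpow : x q ^ M * x p ^ M ≤ (x p * x q) ^ N p q := by
      rw [← mul_pow, mul_comm, ← Nat.add_sub_cancel' (hM p hp q hq), pow_add]
      exact mul_le_left_of_isIntegral hA _ _
    rw [← mul_assoc]
    exact (mul_le_mul_left hpow _).trans (hN p q)
  refine ⟨∑ p ∈ t, x p ^ M * a p, Subtype.ext (funext fun r => ?_)⟩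
  obtain ⟨q, hq, hr⟩ := (r.sum_mem_iff t x).1 (ht r.one_mem)
  refine Eq.trans ?_ (ha q r hr).symm
  -- One inequality is `hglue` summand by summand; the other holds because `x q ^ M * a q` is itself
  -- a summand.
  refine (toStalk_eq_iff hA).2 ⟨x q ^ M, r.pow_mem hr M, ?_, ?_⟩
  · rw [Finset.mul_sum]
    exact sum_le fun p hp => hglue p hp q hq
  · exact Finset.single_le_sum (f := fun p => x p ^ M * a p) (fun _ _ => zero_le) hq

theorem exists_stalks_representation (hA : IsIntegral A) :
    ∃ (E : RigLocalHomeo.{u, u} (Spectrum A)) (e : A ≃+* E.globalSections),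
      ∀ p : Spectrum A,
        IsIntegral (E.Fiber p) ∧ IsReallyLocal (E.Fiber p) ∧
          IsLocalizationAt p.preimageTop ((E.eval p).comp e.toRingHom) :=
  ⟨stalks hA, .ofBijective (toGlobalSections hA)
    ⟨toGlobalSections_injective hA, toGlobalSections_surjective hA⟩, fun p =>
    ⟨isIntegral_stalk hA p, isReallyLocal_stalk hA p, isLocalizationAt_toStalk hA p⟩⟩

end Spectrum

/-- An integral rig is an idempotent semiring. -/
abbrev IsIntegral.idemCommSemiring {A : Type u} [i : CommSemiring A] (hA : IsIntegral A) :
    IdemCommSemiring A :=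
  { i, IdemSemiring.ofSemiring fun a : A => by
      rw [← mul_one a, ← mul_add, hA, mul_one] with }

end IntegralRig

theorem mainTheorem4 (A : Type u) [CommSemiring A] (hA : IntegralRig.IsIntegral A) :
    SpectralSpace (IntegralRig.Spectrum A) ∧
    ∃ (E : IntegralRig.RigLocalHomeo.{u, u} (IntegralRig.Spectrum A))
      (e : A ≃+* E.globalSections),
      ∀ p : IntegralRig.Spectrum A,
        IntegralRig.IsIntegral (E.Fiber p) ∧
        IntegralRig.IsReallyLocal (E.Fiber p) ∧
        IntegralRig.IsLocalizationAt p.preimageTop ((E.eval p).comp e.toRingHom) :=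
  ⟨IntegralRig.Spectrum.spectralSpace,
    -- The idempotent structure extends the given `CommSemiring`, so the spectrum is unchanged.
    @IntegralRig.Spectrum.exists_stalks_representation A hA.idemCommSemiring hA⟩
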